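/- Let $K$ be a field and let $G$ be a finite group of order $m$ and exponent $3$. Let $Pow^{\ast}(G)$ be the punctured power graph of $G$, that is, the directed graph whose vertices are the non-identity elements of $G$, with exactly one edge from $x$ to $y$ if $x\neq y$ and $y=x^k$ for some integer $k$, and no other edges. Then: (1) $Pow^{\ast}(G)$ is isomorphic to the disjoint union of $\frac{m-1}{2}$ copies of the two-cycle, i.e. of the directed graph with two vertices $u,v$ and exactly two edges, one from $u$ to $v$ and one from $v$ to $u$. (2) The Leavitt path algebra $L_K(Pow^{\ast}(G))$ is isomorphic, as a $K$-algebra, to the direct sum $$\bigoplus_{i=1}^{(m-1)/2} M_2(K[x,x^{-1}])$$ of $\frac{m-1}{2}$ copies of the algebra of $2\times 2$ matrices over the Laurent polynomial ring $K[x,x^{-1}]$. Here, for a directed graph $E$ with vertex set $E^0$, edge set $E^1$ and source and range maps $s,r:E^1\to E^0$, the Leavitt path algebra $L_K(E)$ is the quotient of the free associative (not necessarily unital) $K$-algebra on $E^0\cup E^1\cup\{e^{\ast}: e\in E^1\}$ by the relations $vv'=\delta_{v,v'}v$ for $v,v'\in E^0$; $s(e)e=er(e)=e$ and $r(e)e^{\ast}=e^{\ast}s(e)=e^{\ast}$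 for $e\in E^1$; $e^{\ast}e'=\delta_{e,e'}r(e)$ for $e,e'\in E^1$; and $v=\sum_{s(e)=v}ee^{\ast}$ for every $v\in E^0$ with $0<|s^{-1}(v)|<\infty$. -/

import Mathlib

/-- A directed graph: vertices `E⁰`, edges `E¹`, source and range maps
(loops and parallel edges are allowed). -/
structure DirGraph.{u, v} where
  Vert : Type u
  Edge : Type v
  src : Edge → Vert
  rng : Edge → Vert

namespace DirGraph

universe u v u' v' w

/-- A vertex is regular if it emits at least one and only finitely many edges. -/
def IsRegular (E : DirGraph.{u, v}) (a : E.Vert) : Prop :=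
  {e : E.Edge | E.src e = a}.Nonempty ∧ {e : E.Edge | E.src e = a}.Finite

/-- An isomorphism of directed graphs. -/
structure Iso (E : DirGraph.{u, v}) (F : DirGraph.{u', v'}) where
  vert : E.Vert ≃ F.Vert
  edge : E.Edge ≃ F.Edge
  src_edge : ∀ e, F.src (edge e) = vert (E.src e)
  rng_edge : ∀ e, F.rng (edge e) = vert (E.rng e)

/-- The disjoint union of a family of directed graphs. -/
def disjointUnion {ι : Type w} (E : ι → DirGraph.{u, v}) : DirGraph where
  Vert := Σ i, (E i).Vert
  Edge := Σ i, (E i).Edge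
  src e := ⟨e.1, (E e.1).src e.2⟩
  rng e := ⟨e.1, (E e.1).rng e.2⟩

/-- The two-cycle: vertices `0, 1`, an edge `0 → 1` and an edge `1 → 0`. -/
def twoCycle : DirGraph where
  Vert := Fin 2
  Edge := Fin 2
  src i := i
  rng i := i + 1

/-- The graph obtained by removing a vertex and all edges incident with it. -/
def deleteVertex (E : DirGraph.{u, v}) (a : E.Vert) : DirGraph where
  Vert := {b : E.Vert // b ≠ a}
  Edge := {e : E.Edge // E.src e ≠ a ∧ E.rng e ≠ a}
  src e := ⟨E.src e.1, e.2.1⟩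
  rng e := ⟨E.rng e.1, e.2.2⟩

end DirGraph

/-- The power (di)graph of a group: the vertices are the group elements, and there is one edge
from `x` to `y` exactly when `x ≠ y` and `y` is an integer power of `x`. -/
def powerGraph (G : Type*) [Group G] : DirGraph where
  Vert := G
  Edge := {p : G × G // p.1 ≠ p.2 ∧ ∃ k : ℤ, p.2 = p.1 ^ k}
  src e := e.1.1
  rng e := e.1.2

/-- The punctured power (di)graph: the power graph with the identity removed. -/
def puncturedPowerGraph (G : Type*) [Group G] : DirGraph :=
  (powerGraph G).deleteVertex (1 : G)

namespace LeavittPathAlgebra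

universe u v w

/-- The generators of the Leavitt path algebra: vertices, edges and ghost edges. -/
inductive Gen (E : DirGraph.{u, v}) : Type (max u v)
  | vert (a : E.Vert)
  | edge (e : E.Edge)
  | ghost (e : E.Edge)

/-- The free associative (not necessarily unital) `K`-algebra on the generators: the semigroup
algebra of the free semigroup, i.e. `K`-linear combinations of nonempty words. -/
abbrev Free (K : Type w) [Field K] (E : DirGraph.{u, v}) : Type (max u v w) :=
  MonoidAlgebra K (FreeSemigroup (Gen E))

section

variable (K : Type w) [Field K] (E : DirGraph.{u, v})

/-- A generator as an element of the free algebra. -/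
noncomputable def Free.of (g : Gen E) : Free K E :=
  MonoidAlgebra.single (FreeSemigroup.of g) 1

/-- A vertex in the free algebra. -/
noncomputable abbrev Free.vert (a : E.Vert) : Free K E := Free.of K E (Gen.vert a)

/-- An edge in the free algebra. -/
noncomputable abbrev Free.edge (e : E.Edge) : Free K E := Free.of K E (Gen.edge e)

/-- A ghost edge in the free algebra. -/
noncomputable abbrev Free.ghost (e : E.Edge) : Free K E := Free.of K E (Gen.ghost e)

/-- The defining relations (V), (E1), (E2), (CK1), (CK2) of the Leavitt path algebra. -/
inductive DefRel : Free K E → Free K E → Prop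
  | v_same (a : E.Vert) : DefRel (Free.vert K E a * Free.vert K E a) (Free.vert K E a)
  | v_diff (a b : E.Vert) (h : a ≠ b) : DefRel (Free.vert K E a * Free.vert K E b) 0
  | e1_src (e : E.Edge) : DefRel (Free.vert K E (E.src e) * Free.edge K E e) (Free.edge K E e)
  | e1_rng (e : E.Edge) : DefRel (Free.edge K E e * Free.vert K E (E.rng e)) (Free.edge K E e)
  | e2_rng (e : E.Edge) : DefRel (Free.vert K E (E.rng e) * Free.ghost K E e) (Free.ghost K E e)
  | e2_src (e : E.Edge) : DefRel (Free.ghost K E e * Free.vert K E (E.src e)) (Free.ghost K E e)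
  | ck1_same (e : E.Edge) :
      DefRel (Free.ghost K E e * Free.edge K E e) (Free.vert K E (E.rng e))
  | ck1_diff (e f : E.Edge) (h : e ≠ f) : DefRel (Free.ghost K E e * Free.edge K E f) 0
  | ck2 (a : E.Vert) (h : E.IsRegular a) :
      DefRel (Free.vert K E a)
        (∑ e ∈ h.2.toFinset, Free.edge K E e * Free.ghost K E e)

/-- The `K`-algebra congruence generated by the defining relations. (The free algebra has no unit,
so the scalar multiples of the relations have to be added before the ring congruence is taken.) -/
noncomputable def con : RingCon (Free K E) :=
  ringConGen fun x y => ∃ (k : K) (x' y' : Free K E), DefRel K E x' y' ∧ x = k • x' ∧ y = k • y'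

theorem con_smul (k : K) {x y : Free K E} (h : con K E x y) : con K E (k • x) (k • y) := by
  induction h with
  | of x y h =>
    obtain ⟨l, x', y', h, rfl, rfl⟩ := h
    exact RingConGen.Rel.of _ _ ⟨k * l, x', y', h, (mul_smul _ _ _).symm, (mul_smul _ _ _).symm⟩
  | refl x => exact RingConGen.Rel.refl _
  | symm _ ih => exact RingConGen.Rel.symm ih
  | trans _ _ ih₁ ih₂ => exact RingConGen.Rel.trans ih₁ ih₂
  | add _ _ ih₁ ih₂ => rw [smul_add, smul_add]; exact RingConGen.Rel.add ih₁ ih₂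
  | mul _ h₂ ih₁ _ =>
    rw [← smul_mul_assoc, ← smul_mul_assoc]; exact RingConGen.Rel.mul ih₁ h₂

end

end LeavittPathAlgebra

/-- The Leavitt path algebra `L_K(E)`: the free associative `K`-algebra on
`E⁰ ∪ E¹ ∪ (E¹)*` modulo the defining relations. -/
def LeavittPathAlgebra (K : Type*) [Field K] (E : DirGraph) : Type _ :=
  (LeavittPathAlgebra.con K E).Quotient

namespace LeavittPathAlgebra

universe u v w

variable (K : Type w) [Field K] (E : DirGraph.{u, v})

noncomputable instance : NonUnitalRing (LeavittPathAlgebra K E) :=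
  inferInstanceAs (NonUnitalRing (con K E).Quotient)

noncomputable instance : SMul K (LeavittPathAlgebra K E) where
  smul k := Quotient.map (k • ·) fun _ _ h => con_smul K E k h

noncomputable instance : Module K (LeavittPathAlgebra K E) where
  one_smul := by
    rintro ⟨x⟩; exact congrArg (Quotient.mk _) (one_smul K x)
  mul_smul k l := by
    rintro ⟨x⟩; exact congrArg (Quotient.mk _) (mul_smul k l x)
  smul_zero k := congrArg (Quotient.mk _) (smul_zero k)
  smul_add k := by
    rintro ⟨x⟩ ⟨y⟩; exact congrArg (Quotient.mk _) (smul_add k x y)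
  add_smul k l := by
    rintro ⟨x⟩; exact congrArg (Quotient.mk _) (add_smul k l x)
  zero_smul := by
    rintro ⟨x⟩; exact congrArg (Quotient.mk _) (zero_smul K x)

instance : IsScalarTower K (LeavittPathAlgebra K E) (LeavittPathAlgebra K E) where
  smul_assoc k := by
    rintro ⟨x⟩ ⟨y⟩; exact congrArg (Quotient.mk _) (smul_mul_assoc k x y)

instance : SMulCommClass K (LeavittPathAlgebra K E) (LeavittPathAlgebra K E) where
  smul_comm k := by
    rintro ⟨x⟩ ⟨y⟩; exact congrArg (Quotient.mk _) (mul_smul_comm k x y).symm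

end LeavittPathAlgebra

/-! In exponent 3 the powers of x are 1, x and x⁻¹, and x⁻¹ ≠ x unless x = 1. So every vertex of the
punctured power graph emits exactly one edge, to its inverse, and the graph consists of the orbits
of the fixed-point-free involution x ↦ x⁻¹.

In a disjoint union of two-cycles every vertex emits a single edge e, so (CK2) reads e e* = s(e),
while (CK1) gives e* e = r(e): ghosts are inverse edges. Hence every word reduces to zero or to a
path of some integer length n from some vertex a, and these paths span (`span_cyclePath`). Send the
vertex a to E_aa, the edge 0 → 1 to E_01, the edge 1 → 0 to T E_10, and ghosts to the inverse matrix
units. The path (n, a) then goes to T^k E_ab with a + n = 2k + b (`toMatrix_cyclePath`). Division by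
2 with remainder makes n ↔ (k, b) a bijection for fixed a, so the spanning paths correspond to a
basis of the product of matrix algebras, and the homomorphism is bijective. -/

/-! ### The punctured power graph in exponent three. -/

/-- A fixed-point-free involution of a finite type is, up to a labelling of the type by
`Fin n × Fin 2`, the swap of the second coordinate. -/
theorem exists_equiv_of_involutive_of_fixedPointFree {V : Type*} [Finite V] (σ : V → V)
    (hσ : Function.Involutive σ) (hfix : ∀ x, σ x ≠ x) :
    ∃ φ : V ≃ Σ _ : Fin (Nat.card V / 2), Fin 2,
      ∀ x, φ (σ x) = ⟨(φ x).1, (φ x).2 + 1⟩ := by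
  let r : Setoid V :=
    { r := fun x y => x = y ∨ x = σ y
      iseqv :=
        { refl := fun x => Or.inl rfl
          symm := by
            rintro x y (rfl | rfl)
            · exact Or.inl rfl
            · exact Or.inr (hσ y).symm
          trans := by
            rintro x y z (rfl | rfl) (rfl | rfl)
            · exact Or.inl rfl
            · exact Or.inr rfl
            · exact Or.inr rfl
            · exact Or.inl (hσ z) } }
  -- Each orbit has a chosen representative, labelled 0; its image under σ is labelled 1.
  let ψ : Quotient r × Fin 2 → V := fun p => if p.2 = 0 then p.1.out else σ p.1.out
  have hψ0 : ∀ q, ψ (q, 0) = q.out := fun q => if_pos rfl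
  have hψ1 : ∀ q, ψ (q, 1) = σ q.out := fun q => if_neg (by simp)
  have hout : ∀ p, Quotient.mk r (ψ p) = p.1 := by
    rintro ⟨q, a⟩
    fin_cases a
    · exact (congrArg _ (hψ0 q)).trans q.out_eq
    · exact (congrArg _ (hψ1 q)).trans ((Quotient.sound (Or.inr rfl)).trans q.out_eq)
  have hbij : Function.Bijective ψ := by
    constructor
    · rintro ⟨q, a⟩ ⟨q', b⟩ h
      obtain rfl : q = q' := (hout (q, a)).symm.trans ((congrArg _ h).trans (hout (q', b)))
      fin_cases a <;> fin_cases b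
      · rfl
      · exact absurd h.symm (by simpa [ψ] using hfix q.out)
      · exact absurd h (by simpa [ψ] using hfix q.out)
      · rfl
    · intro x
      rcases Quotient.exact (Quotient.out_eq (Quotient.mk r x)) with h | h
      · exact ⟨(Quotient.mk r x, 0), (hψ0 _).trans h⟩
      · exact ⟨(Quotient.mk r x, 1), (hψ1 _).trans ((congrArg σ h).trans (hσ x))⟩
  let e := Equiv.ofBijective ψ hbij
  have hcard : Nat.card (Quotient r) = Nat.card V / 2 := by
    rw [← Nat.card_congr e, Nat.card_prod, Nat.card_fin, Nat.mul_div_cancel _ two_pos]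
  refine ⟨(e.symm.trans ((Finite.equivFinOfCardEq hcard).prodCongr (Equiv.refl _))).trans
    (Equiv.sigmaEquivProd _ _).symm, fun x => ?_⟩
  obtain ⟨⟨q, a⟩, rfl⟩ := e.surjective x
  -- The relation 1 + 1 = 0 in `Fin 2` matches σ ∘ σ = id.
  have : σ (e (q, a)) = e (q, a + 1) := by
    fin_cases a
    · exact (congrArg σ (hψ0 q)).trans (hψ1 q).symm
    · exact (congrArg σ (hψ1 q)).trans ((hσ _).trans (hψ0 q).symm)
  simp [this]

/-- The punctured power graph of a finite group of exponent three is a disjoint union of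
two-cycles, formed by the pairs `x, x⁻¹`. -/
theorem nonempty_puncturedPowerGraph_iso (G : Type*) [Group G] [Finite G]
    (hexp : Monoid.exponent G = 3) :
    Nonempty ((puncturedPowerGraph G).Iso
      (DirGraph.disjointUnion fun _ : Fin ((Nat.card G - 1) / 2) => DirGraph.twoCycle)) := by
  have h3 : ∀ x : G, x ^ 3 = 1 := fun x => hexp ▸ Monoid.pow_exponent_eq_one x
  have hinv : ∀ x : G, x⁻¹ = x ^ 2 := fun x => inv_eq_of_mul_eq_one_right (by
    rw [← pow_succ']; exact h3 x)
  have hne : ∀ x : G, x ≠ 1 → x⁻¹ ≠ x := fun x hx h => hx (by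
    rw [hinv, pow_two] at h; simpa using h)
  have hpow : ∀ (x : G) (k : ℤ), x ^ k = 1 ∨ x ^ k = x ∨ x ^ k = x⁻¹ := by
    intro x k
    have h3' : x ^ (3 : ℤ) = 1 := by exact_mod_cast h3 x
    -- Since x³ = 1, only the residue of k modulo 3 matters.
    rw [← Int.emod_add_mul_ediv k 3, zpow_add, zpow_mul, h3', one_zpow, mul_one]
    have h0 := Int.emod_nonneg k (by norm_num : (3 : ℤ) ≠ 0)
    have h1 := Int.emod_lt_of_pos k (by norm_num : (0 : ℤ) < 3)
    rw [hinv]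
    generalize k % 3 = l at *
    interval_cases l
    · simp
    · simp
    · right; right; exact_mod_cast rfl
  have hcard : Nat.card {x : G // x ≠ 1} = Nat.card G - 1 := by
    have := Fintype.ofFinite G
    classical
    rw [Nat.card_eq_fintype_card, Nat.card_eq_fintype_card, Fintype.card_subtype_compl,
      Fintype.card_subtype_eq]
  rw [← hcard]
  obtain ⟨φ, hφ⟩ := exists_equiv_of_involutive_of_fixedPointFree
    (fun x : {x : G // x ≠ 1} => ⟨x.1⁻¹, inv_ne_one.mpr x.2⟩)
    (fun x => Subtype.ext (inv_inv x.1)) (fun x h => hne x.1 x.2 (congrArg Subtype.val h))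
  -- Of the three possible powers, 1 is a deleted vertex and x itself is excluded as a loop.
  have hrng : ∀ e : (puncturedPowerGraph G).Edge, e.1.1.2 = (e.1.1.1 : G)⁻¹ := by
    rintro ⟨⟨⟨x, y⟩, hxy, k, hk⟩, hx, hy⟩
    rcases hpow x k with h | h | h
    · exact absurd (hk.trans h) hy
    · exact absurd (hk.trans h).symm hxy
    · exact hk.trans h
  -- Every vertex emits exactly one edge, so edges can be labelled by their sources.
  have hsrc : Function.Bijective (puncturedPowerGraph G).src := by
    constructor
    · intro e f h
      have h : e.1.1.1 = f.1.1.1 := congrArg Subtype.val h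
      exact Subtype.ext (Subtype.ext (Prod.ext h (by rw [hrng, hrng, h])))
    · rintro ⟨(x : G), (hx : x ≠ 1)⟩
      exact ⟨⟨⟨(x, x⁻¹), (hne x hx).symm, -1, (zpow_neg_one x).symm⟩, hx,
        (inv_ne_one (a := x)).mpr hx⟩, rfl⟩
  exact ⟨{
    vert := φ
    edge := (Equiv.ofBijective _ hsrc).trans φ
    src_edge := fun _ => rfl
    rng_edge := fun e => (hφ ⟨e.1.1.1, e.2.1⟩).symm.trans
      (congrArg φ (Subtype.ext (hrng e).symm)) }⟩

/-! ### Relations and universal property of the Leavitt path algebra. -/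

namespace LeavittPathAlgebra

universe u v w

variable (K : Type w) [Field K] (E : DirGraph.{u, v})

/-- The quotient map from the free algebra to the Leavitt path algebra. -/
noncomputable def mkHom : Free K E →ₙₐ[K] LeavittPathAlgebra K E where
  toFun := Quotient.mk _
  map_smul' _ _ := rfl
  map_zero' := rfl
  map_add' _ _ := rfl
  map_mul' _ _ := rfl

theorem mkHom_surjective : Function.Surjective (mkHom K E) := Quotient.mk_surjective

variable {K E} in
theorem mkHom_eq_of_defRel {x y : Free K E} (h : DefRel K E x y) : mkHom K E x = mkHom K E y :=
  Quotient.sound (RingConGen.Rel.of _ _ ⟨1, x, y, h, (one_smul K x).symm, (one_smul K y).symm⟩)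

/-- A generator as an element of the Leavitt path algebra. -/
noncomputable def of (g : Gen E) : LeavittPathAlgebra K E := mkHom K E (Free.of K E g)

theorem vert_mul_vert_self (a : E.Vert) :
    of K E (.vert a) * of K E (.vert a) = of K E (.vert a) := by
  simpa [of] using mkHom_eq_of_defRel (DefRel.v_same (K := K) a)

theorem vert_mul_vert_of_ne {a b : E.Vert} (h : a ≠ b) :
    of K E (.vert a) * of K E (.vert b) = 0 := by
  simpa [of] using mkHom_eq_of_defRel (DefRel.v_diff (K := K) a b h)

theorem src_mul_edge (e : E.Edge) :
    of K E (.vert (E.src e)) * of K E (.edge e) = of K E (.edge e) := by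
  simpa [of] using mkHom_eq_of_defRel (DefRel.e1_src (K := K) e)

theorem edge_mul_rng (e : E.Edge) :
    of K E (.edge e) * of K E (.vert (E.rng e)) = of K E (.edge e) := by
  simpa [of] using mkHom_eq_of_defRel (DefRel.e1_rng (K := K) e)

theorem rng_mul_ghost (e : E.Edge) :
    of K E (.vert (E.rng e)) * of K E (.ghost e) = of K E (.ghost e) := by
  simpa [of] using mkHom_eq_of_defRel (DefRel.e2_rng (K := K) e)

theorem ghost_mul_src (e : E.Edge) :
    of K E (.ghost e) * of K E (.vert (E.src e)) = of K E (.ghost e) := by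
  simpa [of] using mkHom_eq_of_defRel (DefRel.e2_src (K := K) e)

theorem ghost_mul_edge_self (e : E.Edge) :
    of K E (.ghost e) * of K E (.edge e) = of K E (.vert (E.rng e)) := by
  simpa [of] using mkHom_eq_of_defRel (DefRel.ck1_same (K := K) e)

/-- If `e` is the only edge emitted by its source, then `e e* = s(e)`. -/
theorem edge_mul_ghost_self (e : E.Edge) (he : ∀ f, E.src f = E.src e → f = e) :
    of K E (.edge e) * of K E (.ghost e) = of K E (.vert (E.src e)) := by
  have hs : {f : E.Edge | E.src f = E.src e} = {e} :=
    Set.eq_singleton_iff_unique_mem.mpr ⟨rfl, he⟩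
  have h : E.IsRegular (E.src e) := by
    unfold DirGraph.IsRegular
    rw [hs]
    exact ⟨Set.singleton_nonempty e, Set.finite_singleton e⟩
  have hf : h.2.toFinset = {e} := by ext; simp [Set.ext_iff] at hs ⊢; exact hs _
  have := mkHom_eq_of_defRel (DefRel.ck2 (K := K) _ h)
  rw [hf, Finset.sum_singleton, map_mul] at this
  exact this.symm

section lift

variable {K E}
variable {A : Type*} [NonUnitalRing A] [Module K A] [IsScalarTower K A A] [SMulCommClass K A A]

/-- The homomorphism from the free algebra determined by the images of the generators. -/
noncomputable def freeLift (g : Gen E → A) : Free K E →ₙₐ[K] A :=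
  MonoidAlgebra.liftMagma K (FreeSemigroup.lift g)

@[simp]
theorem freeLift_of (g : Gen E → A) (x : Gen E) : freeLift g (Free.of K E x) = g x := by
  simp [freeLift, Free.of]

/-- The universal property of the Leavitt path algebra. -/
noncomputable def lift (g : Gen E → A)
    (hg : ∀ x y, DefRel K E x y → freeLift g x = freeLift g y) :
    LeavittPathAlgebra K E →ₙₐ[K] A :=
  have hcon : ∀ x y, con K E x y → freeLift g x = freeLift g y := by
    intro x y h
    induction h with
    | of x y h =>
      obtain ⟨k, x', y', h, rfl, rfl⟩ := h
      rw [map_smul, map_smul, hg _ _ h]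
    | refl x => rfl
    | symm _ ih => exact ih.symm
    | trans _ _ ih₁ ih₂ => exact ih₁.trans ih₂
    | add _ _ ih₁ ih₂ => rw [map_add, map_add, ih₁, ih₂]
    | mul _ _ ih₁ ih₂ => rw [map_mul, map_mul, ih₁, ih₂]
  { toFun := Quotient.lift (freeLift g) hcon
    map_smul' := fun k => by rintro ⟨x⟩; exact map_smul (freeLift g) k x
    map_zero' := map_zero (freeLift g)
    map_add' := by rintro ⟨x⟩ ⟨y⟩; exact map_add (freeLift g) x y
    map_mul' := by rintro ⟨x⟩ ⟨y⟩; exact map_mul (freeLift g) x y }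

@[simp]
theorem lift_of (g : Gen E → A) (hg : ∀ x y, DefRel K E x y → freeLift g x = freeLift g y)
    (x : Gen E) : lift g hg (of K E x) = g x :=
  freeLift_of g x

end lift

/-- A subspace containing the generators and closed under left multiplication by them is
everything. -/
theorem eq_top_of_of_mem_of_mul_mem (S : Submodule K (LeavittPathAlgebra K E))
    (hof : ∀ g, of K E g ∈ S) (hmul : ∀ g, ∀ x ∈ S, of K E g * x ∈ S) : S = ⊤ := by
  rw [eq_top_iff]
  rintro x -
  obtain ⟨x, rfl⟩ := mkHom_surjective K E x
  induction x using MonoidAlgebra.induction_linear with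
  | zero => rw [map_zero]; exact S.zero_mem
  | add x y hx hy => rw [map_add]; exact S.add_mem hx hy
  | single w r =>
    -- The scalar is pulled out, leaving a word with coefficient 1.
    rw [← mul_one r, ← smul_eq_mul, ← MonoidAlgebra.smul_single, map_smul]
    refine S.smul_mem r ?_
    induction w using FreeSemigroup.recOnMul with
    | ih1 g => exact hof g
    | ih2 g w _ hw =>
      have := hmul g _ hw
      rwa [of, Free.of, ← map_mul, MonoidAlgebra.single_mul_single, mul_one] at this

end LeavittPathAlgebra

/-! ### Labelled disjoint unions of two-cycles. -/

namespace DirGraph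

universe u v t

/-- A labelling of the vertices and the edges of a graph that exhibits it as a disjoint union of
two-cycles indexed by `ι`: the edge `(i, a)` goes from the vertex `(i, a)` to `(i, a + 1)`. -/
structure TwoCycleLabelling (E : DirGraph.{u, v}) (ι : Type t) where
  vert : ι × Fin 2 ≃ E.Vert
  edge : ι × Fin 2 ≃ E.Edge
  src_edge : ∀ i a, E.src (edge (i, a)) = vert (i, a)
  rng_edge : ∀ i a, E.rng (edge (i, a)) = vert (i, a + 1)

/-- This reduces the sum in (CK2) to a single term. -/
theorem TwoCycleLabelling.src_injective {E : DirGraph.{u, v}} {ι : Type t}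
    (φ : E.TwoCycleLabelling ι) : Function.Injective E.src := by
  intro e f h
  obtain ⟨⟨i, a⟩, rfl⟩ := φ.edge.surjective e
  obtain ⟨⟨j, b⟩, rfl⟩ := φ.edge.surjective f
  rw [φ.src_edge, φ.src_edge] at h
  rw [φ.vert.injective h]

/-- The labelling given by an isomorphism with a disjoint union of two-cycles. -/
def Iso.twoCycleLabelling {E : DirGraph.{u, v}} {ι : Type t}
    (φ : E.Iso (disjointUnion fun _ : ι => twoCycle)) : E.TwoCycleLabelling ι where
  vert := (Equiv.sigmaEquivProd ι (Fin 2)).symm.trans φ.vert.symm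
  edge := (Equiv.sigmaEquivProd ι (Fin 2)).symm.trans φ.edge.symm
  src_edge _ _ := φ.vert.injective ((φ.src_edge _).symm.trans ((congrArg _
    (φ.edge.apply_symm_apply _)).trans (φ.vert.apply_symm_apply _).symm))
  rng_edge _ _ := φ.vert.injective ((φ.rng_edge _).symm.trans ((congrArg _
    (φ.edge.apply_symm_apply _)).trans (φ.vert.apply_symm_apply _).symm))

end DirGraph

/-! ### Paths and ghost paths in the two-cycles. -/

namespace LeavittPathAlgebra

universe u v w t

open LaurentPolynomial

section

variable (K : Type w) [Field K] {E : DirGraph.{u, v}} {ι : Type t}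
  (φ : E.TwoCycleLabelling ι)

/-- The vertex `a` of the `i`-th two-cycle. -/
noncomputable def cycleVert (i : ι) (a : Fin 2) : LeavittPathAlgebra K E :=
  of K E (.vert (φ.vert (i, a)))

/-- The edge of the `i`-th two-cycle emitted by the vertex `a`. -/
noncomputable def cycleEdge (i : ι) (a : Fin 2) : LeavittPathAlgebra K E :=
  of K E (.edge (φ.edge (i, a)))

/-- The ghost of the edge of the `i`-th two-cycle emitted by the vertex `a`. -/
noncomputable def cycleGhost (i : ι) (a : Fin 2) : LeavittPathAlgebra K E :=
  of K E (.ghost (φ.edge (i, a)))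

theorem cycleVert_mul_self (i : ι) (a : Fin 2) :
    cycleVert K φ i a * cycleVert K φ i a = cycleVert K φ i a :=
  vert_mul_vert_self K E _

theorem cycleVert_mul_of_ne {i j : ι} {a b : Fin 2} (h : (i, a) ≠ (j, b)) :
    cycleVert K φ i a * cycleVert K φ j b = 0 :=
  vert_mul_vert_of_ne K E fun h' => h (φ.vert.injective h')

theorem cycleVert_mul_cycleEdge (i : ι) (a : Fin 2) :
    cycleVert K φ i a * cycleEdge K φ i a = cycleEdge K φ i a := by
  rw [cycleVert, cycleEdge, ← φ.src_edge, src_mul_edge]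

theorem cycleEdge_mul_cycleVert (i : ι) (a : Fin 2) :
    cycleEdge K φ i a * cycleVert K φ i (a + 1) = cycleEdge K φ i a := by
  rw [cycleVert, cycleEdge, ← φ.rng_edge, edge_mul_rng]

theorem cycleVert_mul_cycleGhost (i : ι) (a : Fin 2) :
    cycleVert K φ i (a + 1) * cycleGhost K φ i a = cycleGhost K φ i a := by
  rw [cycleVert, cycleGhost, ← φ.rng_edge, rng_mul_ghost]

theorem cycleGhost_mul_cycleVert (i : ι) (a : Fin 2) :
    cycleGhost K φ i a * cycleVert K φ i a = cycleGhost K φ i a := by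
  rw [cycleVert, cycleGhost, ← φ.src_edge, ghost_mul_src]

theorem cycleGhost_mul_cycleEdge (i : ι) (a : Fin 2) :
    cycleGhost K φ i a * cycleEdge K φ i a = cycleVert K φ i (a + 1) := by
  rw [cycleVert, cycleGhost, cycleEdge, ← φ.rng_edge, ghost_mul_edge_self]

theorem cycleEdge_mul_cycleGhost (i : ι) (a : Fin 2) :
    cycleEdge K φ i a * cycleGhost K φ i a = cycleVert K φ i a := by
  rw [cycleVert, cycleGhost, cycleEdge, ← φ.src_edge,
    edge_mul_ghost_self K E _ fun _ h => φ.src_injective h]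

theorem fin_two_add_one_add_one (a : Fin 2) : a + 1 + 1 = a := by
  fin_cases a <;> rfl

/-- The path of length `n` in the `i`-th two-cycle starting at `a`; for negative `n`, the ghost
path of length `-n`. -/
noncomputable def cyclePath (i : ι) : ℤ → Fin 2 → LeavittPathAlgebra K E
  | .ofNat 0, a => cycleVert K φ i a
  | .ofNat (n + 1), a => cycleEdge K φ i a * cyclePath i (.ofNat n) (a + 1)
  -- The edge entering a is the one emitted by a + 1, so its ghost is the backward step from a;
  -- `.negSucc 0` is -1.
  | .negSucc 0, a => cycleGhost K φ i (a + 1)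
  | .negSucc (n + 1), a => cycleGhost K φ i (a + 1) * cyclePath i (.negSucc n) (a + 1)
termination_by n => n.natAbs

theorem cyclePath_zero (i : ι) (a : Fin 2) : cyclePath K φ i 0 a = cycleVert K φ i a := by
  change cyclePath K φ i (.ofNat 0) a = _
  rw [cyclePath]

theorem cyclePath_natCast_succ (i : ι) (n : ℕ) (a : Fin 2) :
    cyclePath K φ i (n + 1) a = cycleEdge K φ i a * cyclePath K φ i n (a + 1) := by
  change cyclePath K φ i (.ofNat (n + 1)) a = _
  rw [cyclePath]
  rfl

theorem cyclePath_neg_natCast_sub_one (i : ι) (n : ℕ) (a : Fin 2) :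
    cyclePath K φ i (-n - 1) a =
      cycleGhost K φ i (a + 1) * cyclePath K φ i (-n) (a + 1) := by
  cases n with
  | zero =>
    change cyclePath K φ i (.negSucc 0) a = _ * cyclePath K φ i 0 _
    rw [cyclePath, cyclePath_zero, cycleGhost_mul_cycleVert]
  | succ n =>
    rw [show (-((n + 1 : ℕ) : ℤ) - 1) = .negSucc (n + 1) by
      rw [Int.negSucc_eq]; push_cast; ring, cyclePath]
    rfl

theorem cycleVert_mul_cyclePath (i : ι) (n : ℤ) (a : Fin 2) :
    cycleVert K φ i a * cyclePath K φ i n a = cyclePath K φ i n a := by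
  induction n using Int.induction_on with
  | zero => rw [cyclePath_zero, cycleVert_mul_self]
  | succ n _ => rw [cyclePath_natCast_succ, ← mul_assoc, cycleVert_mul_cycleEdge]
  | pred n _ =>
    have := cycleVert_mul_cycleGhost K φ i (a + 1)
    rw [fin_two_add_one_add_one] at this
    rw [cyclePath_neg_natCast_sub_one, ← mul_assoc, this]

/-- For n ≥ 0 this is the recursion. For n < 0 the edge meets its own ghost at the head of the path
and cancels it by e e* = s(e), which is where (CK2) enters. -/
theorem cycleEdge_mul_cyclePath (i : ι) (n : ℤ) (a : Fin 2) :
    cycleEdge K φ i a * cyclePath K φ i n (a + 1) = cyclePath K φ i (n + 1) a := by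
  induction n using Int.induction_on with
  | zero => exact (cyclePath_natCast_succ K φ i 0 a).symm
  | succ n _ => exact (cyclePath_natCast_succ K φ i (n + 1) a).symm
  | pred n _ =>
    rw [cyclePath_neg_natCast_sub_one, fin_two_add_one_add_one, ← mul_assoc,
      cycleEdge_mul_cycleGhost, cycleVert_mul_cyclePath, sub_add_cancel]

/-- By the previous lemma any path, even a ghost path, factors as an edge times a path of length n -
1, and the ghost cancels that edge by (CK1). -/
theorem cycleGhost_mul_cyclePath (i : ι) (n : ℤ) (a : Fin 2) :
    cycleGhost K φ i a * cyclePath K φ i n a = cyclePath K φ i (n - 1) (a + 1) := by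
  rw [← sub_add_cancel n 1, ← cycleEdge_mul_cyclePath, ← mul_assoc, cycleGhost_mul_cycleEdge,
    cycleVert_mul_cyclePath, sub_add_cancel]

theorem cycleVert_mul_cyclePath_of_ne {i j : ι} {a b : Fin 2} (h : (i, a) ≠ (j, b)) (n : ℤ) :
    cycleVert K φ i a * cyclePath K φ j n b = 0 := by
  rw [← cycleVert_mul_cyclePath, ← mul_assoc, cycleVert_mul_of_ne K φ h, zero_mul]

theorem cycleEdge_mul_cyclePath_of_ne {i j : ι} {a b : Fin 2} (h : (i, a + 1) ≠ (j, b)) (n : ℤ) :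
    cycleEdge K φ i a * cyclePath K φ j n b = 0 := by
  rw [← cycleEdge_mul_cycleVert, mul_assoc, cycleVert_mul_cyclePath_of_ne K φ h, mul_zero]

theorem cycleGhost_mul_cyclePath_of_ne {i j : ι} {a b : Fin 2} (h : (i, a) ≠ (j, b)) (n : ℤ) :
    cycleGhost K φ i a * cyclePath K φ j n b = 0 := by
  rw [← cycleGhost_mul_cycleVert, mul_assoc, cycleVert_mul_cyclePath_of_ne K φ h, mul_zero]

/-- The Leavitt path algebra of a disjoint union of two-cycles is spanned by the paths and the
ghost paths. -/
theorem span_cyclePath :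
    Submodule.span K (Set.range fun p : ι × ℤ × Fin 2 => cyclePath K φ p.1 p.2.1 p.2.2) = ⊤ := by
  set S := Submodule.span K (Set.range fun p : ι × ℤ × Fin 2 => cyclePath K φ p.1 p.2.1 p.2.2)
    with hS
  have hmem : ∀ i n a, cyclePath K φ i n a ∈ S := fun i n a =>
    Submodule.subset_span ⟨(i, n, a), rfl⟩
  have hgen : ∀ g, (∃ i a, of K E g = cycleVert K φ i a) ∨ (∃ i a, of K E g = cycleEdge K φ i a) ∨
      ∃ i a, of K E g = cycleGhost K φ i a := by
    rintro (x | e | e)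
    · obtain ⟨⟨i, a⟩, rfl⟩ := φ.vert.surjective x
      exact Or.inl ⟨i, a, rfl⟩
    · obtain ⟨⟨i, a⟩, rfl⟩ := φ.edge.surjective e
      exact Or.inr (Or.inl ⟨i, a, rfl⟩)
    · obtain ⟨⟨i, a⟩, rfl⟩ := φ.edge.surjective e
      exact Or.inr (Or.inr ⟨i, a, rfl⟩)
  apply eq_top_of_of_mem_of_mul_mem
  · intro g
    rcases hgen g with ⟨i, a, h⟩ | ⟨i, a, h⟩ | ⟨i, a, h⟩ <;> rw [h]
    · rw [← cyclePath_zero]; exact hmem _ _ _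
    -- An edge is itself times its range vertex, that is, times a path of length 0.
    · rw [← cycleEdge_mul_cycleVert, ← cyclePath_zero, cycleEdge_mul_cyclePath]; exact hmem _ _ _
    · rw [← cycleGhost_mul_cycleVert, ← cyclePath_zero, cycleGhost_mul_cyclePath]
      exact hmem _ _ _
  · intro g x hx
    induction hx using Submodule.span_induction with
    | zero => rw [mul_zero]; exact S.zero_mem
    | add x y _ _ hx hy => rw [mul_add]; exact S.add_mem hx hy
    | smul k x _ hx => rw [mul_smul_comm]; exact S.smul_mem k hx
    | mem x hx =>
      obtain ⟨⟨j, n, b⟩, rfl⟩ := hx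
      rcases hgen g with ⟨i, a, h⟩ | ⟨i, a, h⟩ | ⟨i, a, h⟩ <;> rw [h]
      · by_cases hab : (i, a) = (j, b)
        · obtain ⟨rfl, rfl⟩ := Prod.mk.inj hab
          rw [cycleVert_mul_cyclePath]; exact hmem _ _ _
        · rw [cycleVert_mul_cyclePath_of_ne K φ hab]; exact S.zero_mem
      · by_cases hab : (i, a + 1) = (j, b)
        · obtain ⟨rfl, rfl⟩ := Prod.mk.inj hab
          rw [cycleEdge_mul_cyclePath]; exact hmem _ _ _
        · rw [cycleEdge_mul_cyclePath_of_ne K φ hab]; exact S.zero_mem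
      · by_cases hab : (i, a) = (j, b)
        · obtain ⟨rfl, rfl⟩ := Prod.mk.inj hab
          rw [cycleGhost_mul_cyclePath]; exact hmem _ _ _
        · rw [cycleGhost_mul_cyclePath_of_ne K φ hab]; exact S.zero_mem

end

/-! ### The matrix representation and its inverse. -/

section

variable (K : Type w) [Field K] {ι : Type t} [DecidableEq ι]

/-- The matrix unit `x E_{ab}` in the `i`-th factor. -/
noncomputable def matrixUnit (i : ι) (a b : Fin 2) (x : K[T;T⁻¹]) : ι → Matrix (Fin 2) (Fin 2) K[T;T⁻¹] :=
  Pi.single i (Matrix.single a b x)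

theorem matrixUnit_mul_same (i : ι) (a b c : Fin 2) (x y : K[T;T⁻¹]) :
    matrixUnit K i a b x * matrixUnit K i b c y = matrixUnit K i a c (x * y) := by
  rw [matrixUnit, matrixUnit, ← Pi.single_mul, Matrix.single_mul_single_same, matrixUnit]

theorem matrixUnit_mul_of_ne {i j : ι} {a b c d : Fin 2} (h : (i, b) ≠ (j, c)) (x y : K[T;T⁻¹]) :
    matrixUnit K i a b x * matrixUnit K j c d y = 0 := by
  by_cases hij : i = j
  · subst hij
    have hbc : b ≠ c := fun hbc => h (by rw [hbc])
    rw [matrixUnit, matrixUnit, ← Pi.single_mul, Matrix.single_mul_single_of_ne _ _ _ _ hbc,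
      Pi.single_zero]
  · funext k
    rw [matrixUnit, matrixUnit, Pi.mul_apply, Pi.zero_apply]
    by_cases hk : k = i
    · rw [Pi.single_eq_of_ne (M := fun _ => Matrix (Fin 2) (Fin 2) K[T;T⁻¹])
        (i := j) (fun h => hij (hk.symm.trans h)), mul_zero]
    · rw [Pi.single_eq_of_ne hk, zero_mul]

variable {K} {E : DirGraph.{u, v}}
  (φ : E.TwoCycleLabelling ι)

variable (K) in
/-- The images of the generators in the product of matrix algebras. -/
noncomputable def genToMatrix : Gen E → ι → Matrix (Fin 2) (Fin 2) K[T;T⁻¹]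
  | .vert x => matrixUnit K (φ.vert.symm x).1 (φ.vert.symm x).2 (φ.vert.symm x).2 1
  -- The exponent is 0 on the edge 0 → 1 and 1 on the edge 1 → 0, so one full turn around the cycle
  -- contributes exactly one factor T.
  | .edge e =>
    matrixUnit K (φ.edge.symm e).1 (φ.edge.symm e).2 ((φ.edge.symm e).2 + 1)
      (T ((φ.edge.symm e).2 : ℕ))
  | .ghost e =>
    matrixUnit K (φ.edge.symm e).1 ((φ.edge.symm e).2 + 1) (φ.edge.symm e).2
      (T (-((φ.edge.symm e).2 : ℕ)))

theorem genToMatrix_vert (i : ι) (a : Fin 2) :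
    genToMatrix K φ (.vert (φ.vert (i, a))) = matrixUnit K i a a 1 := by
  rw [genToMatrix, Equiv.symm_apply_apply]

theorem genToMatrix_edge (i : ι) (a : Fin 2) :
    genToMatrix K φ (.edge (φ.edge (i, a))) = matrixUnit K i a (a + 1) (T (a : ℕ)) := by
  rw [genToMatrix, Equiv.symm_apply_apply]

theorem genToMatrix_ghost (i : ι) (a : Fin 2) :
    genToMatrix K φ (.ghost (φ.edge (i, a))) = matrixUnit K i (a + 1) a (T (-(a : ℕ))) := by
  rw [genToMatrix, Equiv.symm_apply_apply]

theorem T_mul_T_neg (n : ℤ) : (T n * T (-n) : K[T;T⁻¹]) = 1 := by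
  rw [← T_add, add_neg_cancel, T_zero]

theorem T_neg_mul_T (n : ℤ) : (T (-n) * T n : K[T;T⁻¹]) = 1 := by
  rw [← T_add, neg_add_cancel, T_zero]

theorem freeLift_genToMatrix_eq {x y : Free K E} (h : DefRel K E x y) :
    freeLift (genToMatrix K φ) x = freeLift (genToMatrix K φ) y := by
  cases h with
  | v_same x =>
    obtain ⟨⟨i, a⟩, rfl⟩ := φ.vert.surjective x
    simp [genToMatrix_vert, matrixUnit_mul_same]
  | v_diff x y h =>
    obtain ⟨⟨i, a⟩, rfl⟩ := φ.vert.surjective x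
    obtain ⟨⟨j, b⟩, rfl⟩ := φ.vert.surjective y
    simp only [map_mul, freeLift_of, map_zero, genToMatrix_vert]
    exact matrixUnit_mul_of_ne K (φ.vert.injective.ne_iff.mp h) _ _
  | e1_src e =>
    obtain ⟨⟨i, a⟩, rfl⟩ := φ.edge.surjective e
    simp [φ.src_edge, genToMatrix_vert, genToMatrix_edge, matrixUnit_mul_same]
  | e1_rng e =>
    obtain ⟨⟨i, a⟩, rfl⟩ := φ.edge.surjective e
    simp [φ.rng_edge, genToMatrix_vert, genToMatrix_edge, matrixUnit_mul_same]
  | e2_rng e =>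
    obtain ⟨⟨i, a⟩, rfl⟩ := φ.edge.surjective e
    simp [φ.rng_edge, genToMatrix_vert, genToMatrix_ghost, matrixUnit_mul_same]
  | e2_src e =>
    obtain ⟨⟨i, a⟩, rfl⟩ := φ.edge.surjective e
    simp [φ.src_edge, genToMatrix_vert, genToMatrix_ghost, matrixUnit_mul_same]
  | ck1_same e =>
    obtain ⟨⟨i, a⟩, rfl⟩ := φ.edge.surjective e
    rw [map_mul, freeLift_of, freeLift_of, freeLift_of, φ.rng_edge, genToMatrix_vert,
      genToMatrix_edge, genToMatrix_ghost, matrixUnit_mul_same, T_neg_mul_T]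
  | ck1_diff e f h =>
    obtain ⟨⟨i, a⟩, rfl⟩ := φ.edge.surjective e
    obtain ⟨⟨j, b⟩, rfl⟩ := φ.edge.surjective f
    simp only [map_mul, freeLift_of, map_zero, genToMatrix_edge, genToMatrix_ghost]
    exact matrixUnit_mul_of_ne K (φ.edge.injective.ne_iff.mp h) _ _
  | ck2 x h =>
    obtain ⟨e, rfl⟩ := h.1
    have hf : h.2.toFinset = {e} := by
      ext f
      simpa using φ.src_injective.eq_iff
    rw [hf]
    obtain ⟨⟨i, a⟩, rfl⟩ := φ.edge.surjective e
    rw [Finset.sum_singleton, map_mul, freeLift_of, freeLift_of, freeLift_of, φ.src_edge,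
      genToMatrix_vert, genToMatrix_edge, genToMatrix_ghost, matrixUnit_mul_same, T_mul_T_neg]

variable (K) in
/-- The homomorphism from the Leavitt path algebra of a disjoint union of two-cycles to a product of
matrix algebras over the Laurent polynomials. -/
noncomputable def toMatrix :
    LeavittPathAlgebra K E →ₙₐ[K] (ι → Matrix (Fin 2) (Fin 2) K[T;T⁻¹]) :=
  lift (genToMatrix K φ) fun _ _ h => freeLift_genToMatrix_eq φ h

theorem toMatrix_cycleVert (i : ι) (a : Fin 2) :
    toMatrix K φ (cycleVert K φ i a) = matrixUnit K i a a 1 := by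
  rw [toMatrix, cycleVert, lift_of, genToMatrix_vert]

theorem toMatrix_cycleEdge (i : ι) (a : Fin 2) :
    toMatrix K φ (cycleEdge K φ i a) = matrixUnit K i a (a + 1) (T (a : ℕ)) := by
  rw [toMatrix, cycleEdge, lift_of, genToMatrix_edge]

theorem toMatrix_cycleGhost (i : ι) (a : Fin 2) :
    toMatrix K φ (cycleGhost K φ i a) = matrixUnit K i (a + 1) a (T (-(a : ℕ))) := by
  rw [toMatrix, cycleGhost, lift_of, genToMatrix_ghost]

theorem fin_two_val_add_one (a : Fin 2) : ((a + 1 : Fin 2) : ℕ) = 1 - a := by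
  fin_cases a <;> rfl

/-- The residue of an integer modulo two. -/
def parity (s : ℤ) : Fin 2 := ⟨(s % 2).toNat, by omega⟩

/-- Unrolled onto the integers, the path runs from a to a + n. The parity of the endpoint is the
final vertex, and each step from an odd number up to an even one contributes T (its reverse T⁻¹),
which gives the floor of (a + n)/2. -/
theorem toMatrix_cyclePath (i : ι) (n : ℤ) (a : Fin 2) :
    toMatrix K φ (cyclePath K φ i n a) =
      matrixUnit K i a (parity ((a : ℕ) + n)) (T (((a : ℕ) + n) / 2)) := by
  induction n using Int.induction_on generalizing a with
  | zero =>
    rw [cyclePath_zero, toMatrix_cycleVert]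
    fin_cases a <;> rfl
  | succ n ih =>
    rw [cyclePath_natCast_succ, map_mul, ih, toMatrix_cycleEdge, matrixUnit_mul_same, ← T_add]
    refine congrArg₂ (fun b k => matrixUnit K i a b (T k)) (Fin.ext ?_) ?_
    · simp only [parity, fin_two_val_add_one]
      omega
    · rw [fin_two_val_add_one]
      omega
  | pred n ih =>
    rw [cyclePath_neg_natCast_sub_one, map_mul, ih, toMatrix_cycleGhost, matrixUnit_mul_same,
      ← T_add, fin_two_add_one_add_one]
    refine congrArg₂ (fun b k => matrixUnit K i a b (T k)) (Fin.ext ?_) ?_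
    · simp only [parity, fin_two_val_add_one]
      omega
    · rw [fin_two_val_add_one]
      omega

/-- The length is the solution n of a + n = 2k + b. -/
theorem toMatrix_cyclePath_eq_matrixUnit (i : ι) (a b : Fin 2) (k : ℤ) :
    toMatrix K φ (cyclePath K φ i (2 * k + (b : ℕ) - (a : ℕ)) a) = matrixUnit K i a b (T k) := by
  rw [toMatrix_cyclePath, add_sub_cancel]
  congr 2
  · ext; simp only [parity]; omega
  · omega

/-- The range is a subspace containing every T^k E_ab of every factor; these span the product
because `ι` is finite. -/
theorem toMatrix_surjective [Fintype ι] : Function.Surjective (toMatrix K φ) := by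
  intro M
  let f : LeavittPathAlgebra K E →ₗ[K] (ι → Matrix (Fin 2) (Fin 2) K[T;T⁻¹]) :=
    { toFun := toMatrix K φ
      map_add' := map_add _
      map_smul' := map_smul _ }
  let R := LinearMap.range f
  change M ∈ R
  have key : ∀ i a b x, matrixUnit K i a b x ∈ R := by
    intro i a b x
    induction x using AddMonoidAlgebra.induction_linear with
    | zero => simp [matrixUnit]
    | add x y hx hy =>
      rw [matrixUnit, Matrix.single_add, Pi.single_add]
      exact R.add_mem hx hy
    | single k r =>
      rw [show (AddMonoidAlgebra.single k r : K[T;T⁻¹]) = r • T k by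
        rw [smul_eq_C_mul, single_eq_C_mul_T], matrixUnit,
        ← Matrix.smul_single, Pi.single_smul]
      exact R.smul_mem r ⟨_, toMatrix_cyclePath_eq_matrixUnit φ i a b k⟩
  rw [← Finset.univ_sum_single M]
  refine R.sum_mem fun i _ => ?_
  have : Pi.single i (M i) = ∑ a, ∑ b, matrixUnit K i a b (M i a b) := by
    conv_lhs => rw [Matrix.matrix_eq_sum_single (M i)]
    simp only [matrixUnit]
    exact (map_sum (AddMonoidHom.single (fun _ : ι => Matrix (Fin 2) (Fin 2) K[T;T⁻¹]) i) _ _).trans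
      (Finset.sum_congr rfl fun a _ => map_sum (AddMonoidHom.single (fun _ : ι => Matrix (Fin 2) (Fin 2) K[T;T⁻¹]) i) _ _)
  rw [this]
  exact R.sum_mem fun a _ => R.sum_mem fun b _ => key i a b _

/-- The linear map sending the matrix unit `T ^ k E_{ab}` of the `i`-th factor to the path from `a`
to `b` that winds `k` times around the `i`-th two-cycle. -/
noncomputable def ofMatrix [Fintype ι] :
    (ι → Matrix (Fin 2) (Fin 2) K[T;T⁻¹]) →ₗ[K] LeavittPathAlgebra K E :=
  ∑ i, ∑ a : Fin 2, ∑ b : Fin 2,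
    (Finsupp.linearCombination K fun k : ℤ => cyclePath K φ i (2 * k + (b : ℕ) - (a : ℕ)) a) ∘ₗ
      (AddMonoidAlgebra.coeffLinearEquiv K).toLinearMap ∘ₗ Matrix.entryLinearMap K _ a b ∘ₗ
        LinearMap.proj i

theorem ofMatrix_matrixUnit [Fintype ι] (i : ι) (a b : Fin 2) (k : ℤ) :
    ofMatrix φ (matrixUnit K i a b (T k)) =
      cyclePath K φ i (2 * k + (b : ℕ) - (a : ℕ)) a := by
  simp only [ofMatrix, LinearMap.sum_apply]
  rw [Finset.sum_eq_single i, Finset.sum_eq_single a, Finset.sum_eq_single b]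
  · simp only [matrixUnit, LinearMap.comp_apply, LinearMap.proj_apply, Pi.single_eq_same,
      Matrix.entryLinearMap_apply, Matrix.single_apply_same]
    exact (Finsupp.linearCombination_single K _ _).trans (one_smul K _)
  · intro c _ hc
    simp [matrixUnit, Matrix.single, hc.symm]
  · simp
  · intro c _ hc
    simp [matrixUnit, Matrix.single, hc.symm]
  · simp
  · intro j _ hj
    simp [matrixUnit, Pi.single_eq_of_ne hj]
  · simp

/-- Both sides are linear in x, so it suffices to compare them on the spanning paths. This yields
injectivity without a separate proof that the paths are linearly independent. -/
theorem ofMatrix_toMatrix [Fintype ι] (x : LeavittPathAlgebra K E) :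
    ofMatrix φ (toMatrix K φ x) = x := by
  have hx : x ∈ Submodule.span K
      (Set.range fun p : ι × ℤ × Fin 2 => cyclePath K φ p.1 p.2.1 p.2.2) := by
    rw [span_cyclePath]
    trivial
  induction hx using Submodule.span_induction with
  | zero => rw [map_zero, map_zero]
  | add x y _ _ hx hy => rw [map_add, map_add, hx, hy]
  | smul k x _ hx => rw [map_smul, map_smul, hx]
  | mem x hx =>
    obtain ⟨⟨i, n, a⟩, rfl⟩ := hx
    simp only
    rw [toMatrix_cyclePath, ofMatrix_matrixUnit]
    -- What remains is division with remainder: 2⌊(a + n)/2⌋ + ((a + n) mod 2) - a = n.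
    congr 1
    simp only [parity]
    omega

theorem toMatrix_bijective [Fintype ι] : Function.Bijective (toMatrix K φ) :=
  ⟨Function.LeftInverse.injective (ofMatrix_toMatrix φ), toMatrix_surjective φ⟩

end

end LeavittPathAlgebra

open scoped LaurentPolynomial in
theorem mainTheorem6 (K : Type*) [Field K] (G : Type*) [Group G] [Finite G] (m : ℕ)
    (hm : Nat.card G = m) (hexp : Monoid.exponent G = 3) :
    Nonempty ((puncturedPowerGraph G).Iso
      (DirGraph.disjointUnion fun _ : Fin ((m - 1) / 2) => DirGraph.twoCycle)) ∧
    ∃ f : LeavittPathAlgebra K (puncturedPowerGraph G) →ₙₐ[K]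
        (Fin ((m - 1) / 2) → Matrix (Fin 2) (Fin 2) K[T;T⁻¹]),
      Function.Bijective f := by
  subst hm
  obtain ⟨φ⟩ := nonempty_puncturedPowerGraph_iso G hexp
  exact ⟨⟨φ⟩, _, LeavittPathAlgebra.toMatrix_bijective φ.twoCycleLabelling⟩
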